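/- Let $G$ be a (discrete) group. Let $BG$ be the simplicial set whose $n$-simplices are the $n$-tuples $(g_1,\dots,g_n)\in G^n$ (the bar construction), let $EG$ be the simplicial set whose $n$-simplices are the $(n+1)$-tuples $(x_0,\dots,x_n)\in G^{n+1}$, and let $EG\to BG$, $(x_0,\dots,x_n)\mapsto(x_0^{-1}x_1,\dots,x_{n-1}^{-1}x_n)$, be the universal principal $G$-bundle. Let $B(2,G)\subseteq BG$ be the simplicial subset of those tuples $(g_1,\dots,g_n)$ that generate a subgroup of nilpotency class less than $2$, i.e. whose entries commute pairwise, and let $E(2,G)\to B(2,G)$ be the pullback of $EG\to BG$ along the inclusion $B(2,G)\subseteq BG$. Then $G$ is abelian if and only if (the geometric realization of) $E(2,G)$ is contractible. -/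

import Mathlib

open CategoryTheory

universe u

namespace ClassifyingSpace

theorem partialProd_inv_mul {G : Type u} [Group G] {n : ℕ} (y : Fin (n + 1) → G)
    (j : Fin (n + 1)) :
    Fin.partialProd (fun i : Fin n => (y i.castSucc)⁻¹ * y i.succ) j = (y 0)⁻¹ * y j := by
  induction j using Fin.induction with
  | zero => simp
  | succ i ih => rw [Fin.partialProd_succ, ih]; group

theorem partialProd_mem_closure {G : Type u} [Group G] {n : ℕ} (g : Fin n → G)
    (j : Fin (n + 1)) : Fin.partialProd g j ∈ Subgroup.closure (Set.range g) := by
  induction j using Fin.induction with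
  | zero => simp
  | succ i ih =>
    rw [Fin.partialProd_succ]
    exact mul_mem ih (Subgroup.subset_closure ⟨i, rfl⟩)

/-- The simplicial set `BG` of a discrete group `G` (the bar construction). Its `n`-simplices are
the `n`-tuples `(g₁, …, gₙ)`; a monotone map `f : [m] → [n]` sends such a tuple to the `m`-tuple
with entries `g_{f(i-1)+1} ⋯ g_{f(i)}`, written here as a quotient of partial products. So the
inner faces multiply adjacent entries, the outer faces drop the first or the last entry and the
degeneracies insert `1`. -/
def B (G : Type u) [Group G] : SSet.{u} where
  obj n := Fin n.unop.len → G
  map f := ↾fun g i =>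
    (Fin.partialProd g (f.unop.toOrderHom i.castSucc))⁻¹ *
      Fin.partialProd g (f.unop.toOrderHom i.succ)
  map_id n := by
    ext g i
    exact Fin.partialProd_right_inv g i
  map_comp f h := by
    ext g i
    change _ = (Fin.partialProd (fun j => (Fin.partialProd g (f.unop.toOrderHom j.castSucc))⁻¹ *
        Fin.partialProd g (f.unop.toOrderHom j.succ)) (h.unop.toOrderHom i.castSucc))⁻¹ *
      Fin.partialProd (fun j => (Fin.partialProd g (f.unop.toOrderHom j.castSucc))⁻¹ *
        Fin.partialProd g (f.unop.toOrderHom j.succ)) (h.unop.toOrderHom i.succ)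
    rw [partialProd_inv_mul (fun j => Fin.partialProd g (f.unop.toOrderHom j)),
      partialProd_inv_mul (fun j => Fin.partialProd g (f.unop.toOrderHom j)),
      mul_inv_rev, inv_inv, mul_assoc, mul_inv_cancel_left]
    rfl

/-- The simplicial set `EG`. Its `n`-simplices are the `(n+1)`-tuples `(x₀, …, xₙ)` of elements
of `G`; the group `G` acts freely on it by diagonal left multiplication. -/
def E (G : Type u) : SSet.{u} where
  obj n := Fin (n.unop.len + 1) → G
  map f := ↾fun x i => x (f.unop.toOrderHom i)

/-- The universal principal `G`-bundle `EG → BG`,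
`(x₀, …, xₙ) ↦ (x₀⁻¹ x₁, …, xₙ₋₁⁻¹ xₙ)`: it is onto and its fibres are the `G`-orbits. -/
def proj (G : Type u) [Group G] : E G ⟶ B G where
  app n := ↾fun x i => (x i.castSucc)⁻¹ * x i.succ
  naturality m n f := by
    ext x
    funext i
    change _ = (Fin.partialProd (fun j => (x j.castSucc)⁻¹ * x j.succ)
        (f.unop.toOrderHom i.castSucc))⁻¹ *
      Fin.partialProd (fun j => (x j.castSucc)⁻¹ * x j.succ) (f.unop.toOrderHom i.succ)
    rw [partialProd_inv_mul x, partialProd_inv_mul x, mul_inv_rev, inv_inv, mul_assoc,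
      mul_inv_cancel_left]
    rfl

/-- A subgroup that is nilpotent of class less than `q`. -/
def NilpotentOfClassLT (q : ℕ) {G : Type u} [Group G] (H : Subgroup G) : Prop :=
  Group.IsNilpotent H ∧ Group.nilpotencyClass H < q

theorem NilpotentOfClassLT.mono {q : ℕ} {G : Type u} [Group G] {H K : Subgroup G}
    (hK : NilpotentOfClassLT q K) (h : H ≤ K) : NilpotentOfClassLT q H := by
  obtain ⟨_, hq⟩ := hK
  have hs : Function.Surjective (Subgroup.subgroupOfEquivOfLe h).toMonoidHom :=
    (Subgroup.subgroupOfEquivOfLe h).surjective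
  exact ⟨Group.nilpotent_of_surjective _ hs,
    ((Group.nilpotencyClass_le_of_surjective _ hs).trans
      (Subgroup.nilpotencyClass_le (H.subgroupOf K))).trans_lt hq⟩

/-- The simplicial subset `B(q,G) ⊆ BG` of the tuples `(g₁, …, gₙ)` that generate a subgroup of
nilpotency class less than `q`. For `q = 2` these are the tuples of pairwise commuting elements. -/
def Bnil (q : ℕ) (G : Type u) [Group G] : (B G).Subcomplex where
  obj n := {g : Fin n.unop.len → G | NilpotentOfClassLT q (Subgroup.closure (Set.range g))}
  map f := by
    intro g hg
    refine NilpotentOfClassLT.mono hg ?_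
    rw [Subgroup.closure_le]
    rintro _ ⟨i, rfl⟩
    exact mul_mem (inv_mem (partialProd_mem_closure g _)) (partialProd_mem_closure g _)

/-- The total space `E(q,G)` of the pullback of the principal `G`-bundle `EG → BG` along the
inclusion `B(q,G) ⊆ BG`, as a simplicial subset of `EG`. -/
def Enil (q : ℕ) (G : Type u) [Group G] : (E G).Subcomplex :=
  (Bnil q G).preimage (proj G)

end ClassifyingSpace

open Simplicial Opposite
open scoped commutatorElement

noncomputable section

namespace ClassifyingSpace

/-! If `G` is abelian, every tuple lies in `E(2,G)`, which is then a cone with apex `1`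
(`contractibleSpace_of_cone`).

For the converse, the commutator is a `G`-valued 1-cocycle on `E(2,G)`: `⁅a, b⁆ * ⁅b, c⁆ = ⁅a, c⁆`
as soon as `a⁻¹ * b` and `b⁻¹ * c` commute (`commutator_mul_commutator`). A cocycle is the
transition data of a covering with discrete fibre; over a contractible base this covering has a
section, so the cocycle is a coboundary (`IsCocycle.exists_potential`): `u b = ⁅b, a⁆ * u a` on
every edge. All pairs are edges, since one difference commutes with itself. Edges from `1` have
trivial commutator, so `u` is constant and every commutator is `1`. -/

/-! ### Geometric realization -/

variable {X : SSet.{u}}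

/-- The characteristic map `Δⁿ → |X|` of an `n`-simplex of a simplicial set `X`. -/
def characteristicMap {n : SimplexCategoryᵒᵖ} (x : X.obj n) :
    C(stdSimplex ℝ (Fin (n.unop.len + 1)), |X|) :=
  TopCat.toSSetObjEquiv _ n ((sSetTopAdj.unit.app X).app n x)

theorem characteristicMap_map {m n : SimplexCategory} (f : m ⟶ n) (x : X.obj (op n))
    (t : stdSimplex ℝ (Fin (m.len + 1))) :
    characteristicMap (X.map f.op x) t = characteristicMap x (stdSimplex.map f t) := by
  have h : ∀ (Y : SSet.{u}) (η : X ⟶ Y),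
      η.app (op m) (X.map f.op x) = Y.map f.op (η.app (op n) x) :=
    fun Y η => NatTrans.naturality_apply η f.op x
  have h_eq := congrArg (fun y => TopCat.toSSetObjEquiv |X| (op m) y t)
    (h (TopCat.toSSet.obj |X|) (sSetTopAdj.unit.app X))
  exact h_eq

/-- A compatible family of continuous maps on the simplices of `X` glues to a continuous map on
the geometric realization. -/
theorem exists_realization_desc {Y : Type u} [TopologicalSpace Y]
    (φ : ∀ n : SimplexCategoryᵒᵖ, X.obj n → C(stdSimplex ℝ (Fin (n.unop.len + 1)), Y))
    (hφ : ∀ (m n : SimplexCategory) (f : m ⟶ n) (x : X.obj (op n))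
      (t : stdSimplex ℝ (Fin (m.len + 1))),
      φ (op m) (X.map f.op x) t = φ (op n) x (stdSimplex.map f t)) :
    ∃ F : C(|X|, Y), ∀ (n : SimplexCategoryᵒᵖ) (x : X.obj n) t,
      F (characteristicMap x t) = φ n x t := by
  let α : X ⟶ TopCat.toSSet.obj (TopCat.of Y) :=
    { app := fun n => ↾fun x => (TopCat.toSSetObjEquiv (TopCat.of Y) n).symm (φ n x)
      naturality := fun n m f => by
        ext x
        apply (TopCat.toSSetObjEquiv (TopCat.of Y) m).injective
        ext t
        exact hφ m.unop n.unop f.unop x t }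
  refine ⟨((sSetTopAdj.homEquiv X (TopCat.of Y)).symm α).hom, fun n x t => ?_⟩
  have h : sSetTopAdj.unit.app X ≫
      TopCat.toSSet.map ((sSetTopAdj.homEquiv X (TopCat.of Y)).symm α) = α :=
    (Adjunction.homEquiv_unit ..).symm.trans (Equiv.apply_symm_apply _ _)
  have h_eq := congrArg (fun β => TopCat.toSSetObjEquiv (TopCat.of Y) n (β.app n x) t) h
  exact h_eq

theorem realization_hom_ext {Y : Type u} [TopologicalSpace Y] {F F' : C(|X|, Y)}
    (h : ∀ (n : SimplexCategoryᵒᵖ) (x : X.obj n) t,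
      F (characteristicMap x t) = F' (characteristicMap x t)) : F = F' := by
  have : TopCat.ofHom F = (TopCat.ofHom F' : |X| ⟶ TopCat.of Y) := by
    apply (sSetTopAdj.homEquiv X (TopCat.of Y)).injective
    rw [Adjunction.homEquiv_unit, Adjunction.homEquiv_unit]
    ext n x
    apply (TopCat.toSSetObjEquiv (TopCat.of Y) n).injective
    ext t
    exact h n x t
  exact congrArg TopCat.Hom.hom this

/-- Every point of the geometric realization lies on a simplex. -/
theorem exists_characteristicMap_eq (p : |X|) :
    ∃ (n : SimplexCategoryᵒᵖ) (x : X.obj n) (t : stdSimplex ℝ (Fin (n.unop.len + 1))),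
      characteristicMap x t = p := by
  -- Into an indiscrete space every function is continuous, so the indicator of the union of all
  -- simplices can be compared with the constant `True`.
  let _ : TopologicalSpace (ULift.{u} Prop) := ⊤
  let F : C(|X|, ULift.{u} Prop) := ⟨fun p => ⟨∃ (n : SimplexCategoryᵒᵖ) (x : X.obj n)
    (t : stdSimplex ℝ (Fin (n.unop.len + 1))), characteristicMap x t = p⟩, continuous_top⟩
  let F' : C(|X|, ULift.{u} Prop) := ⟨fun _ => ⟨True⟩, continuous_top⟩
  have h : F = F' := realization_hom_ext fun n x t =>
    ULift.ext _ _ (propext ⟨fun _ => trivial, fun _ => ⟨n, x, t, rfl⟩⟩)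
  have h_eq : (F p).down = (F' p).down := by rw [h]
  exact h_eq.mpr trivial

variable {V : Type u}

/-- The tuple of vertices of a simplex of a simplicial subset of `E V`. -/
def vertices {A : (E V).Subcomplex} {n : SimplexCategoryᵒᵖ} (x : A.toSSet.obj n) :
    Fin (n.unop.len + 1) → V :=
  x.1

/-! ### Barycentric coordinates -/

-- Compatibility with simplicial operators is the regrouping of a sum along the fibres of `f`;
-- repeated vertices of degenerate simplices add their weights.
open Classical in
theorem exists_barycentricCoord (A : (E V).Subcomplex) (v : V) :
    ∃ w : C(|A.toSSet|, ℝ), ∀ (n : SimplexCategoryᵒᵖ) (x : A.toSSet.obj n) t,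
      w (characteristicMap x t) = ∑ i, if vertices x i = v then t i else 0 := by
  obtain ⟨F, hF⟩ := exists_realization_desc (X := A.toSSet) (Y := ULift.{u} ℝ)
    (fun n x => ⟨fun t => ⟨∑ i, if vertices x i = v then t i else 0⟩, by
      refine continuous_uliftUp.comp (continuous_finsetSum _ fun i _ => ?_)
      split_ifs
      · exact (continuous_apply i).comp continuous_subtype_val
      · exact continuous_const⟩)
    (fun m n f x t => by
      apply ULift.ext
      change (∑ i, if vertices x (f i) = v then t i else 0) =
        ∑ j, if vertices x j = v then (stdSimplex.map f t) j else 0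
      simp only [stdSimplex.map_coe, FunOnFinite.linearMap_apply_apply]
      rw [← Finset.sum_fiberwise Finset.univ (fun i => f i)]
      refine Finset.sum_congr rfl fun j _ => ?_
      split_ifs with h
      · refine Finset.sum_congr rfl fun i hi => ?_
        rw [(Finset.mem_filter.1 hi).2, if_pos h]
      · refine Finset.sum_eq_zero fun i hi => ?_
        rw [(Finset.mem_filter.1 hi).2, if_neg h])
  exact ⟨⟨fun p => (F p).down, continuous_uliftDown.comp F.continuous⟩,
    fun n x t => congrArg ULift.down (hF n x t)⟩

/-- The barycentric coordinate at the vertex `v`. -/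
def barycentricCoord (A : (E V).Subcomplex) (v : V) : C(|A.toSSet|, ℝ) :=
  (exists_barycentricCoord A v).choose

open Classical in
theorem barycentricCoord_characteristicMap (A : (E V).Subcomplex) (v : V)
    {n : SimplexCategoryᵒᵖ} (x : A.toSSet.obj n) (t : stdSimplex ℝ (Fin (n.unop.len + 1))) :
    barycentricCoord A v (characteristicMap x t) = ∑ i, if vertices x i = v then t i else 0 :=
  (exists_barycentricCoord A v).choose_spec n x t

/-- The open star of the vertex `v`. -/
def openStar (A : (E V).Subcomplex) (v : V) : Set |A.toSSet| :=
  {p | 0 < barycentricCoord A v p}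

theorem isOpen_openStar (A : (E V).Subcomplex) (v : V) : IsOpen (openStar A v) :=
  isOpen_lt continuous_const (barycentricCoord A v).continuous

/-- Open stars meeting at a point have their centres on any one simplex carrying that point, so the
cocycle identity applies on overlaps. -/
theorem exists_eq_of_mem_openStar {A : (E V).Subcomplex} {v : V} {n : SimplexCategoryᵒᵖ}
    {x : A.toSSet.obj n} {t : stdSimplex ℝ (Fin (n.unop.len + 1))}
    (h : characteristicMap x t ∈ openStar A v) : ∃ i, vertices x i = v := by
  by_contra! hn
  have h_eq : 0 < barycentricCoord A v (characteristicMap x t) := h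
  rw [barycentricCoord_characteristicMap, Finset.sum_eq_zero fun i _ => if_neg (hn i)] at h_eq
  exact lt_irrefl _ h_eq

theorem exists_mem_openStar (A : (E V).Subcomplex) (p : |A.toSSet|) : ∃ v, p ∈ openStar A v := by
  obtain ⟨n, x, t, rfl⟩ := exists_characteristicMap_eq p
  obtain ⟨i, -, hi⟩ : ∃ i ∈ Finset.univ, 0 < t i := by
    by_contra! h
    have h1 := Finset.sum_nonpos h
    rw [stdSimplex.sum_eq_one] at h1
    exact absurd h1 (by norm_num)
  refine ⟨vertices x i, ?_⟩
  change 0 < barycentricCoord A _ _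
  rw [barycentricCoord_characteristicMap]
  refine Finset.sum_pos' (fun j _ => ?_) ⟨i, Finset.mem_univ i, by simpa using hi⟩
  split_ifs
  · exact stdSimplex.zero_le t j
  · exact le_rfl

/-! ### The covering space of a cocycle -/

variable {H : Type*} [Group H]

/-- A function on pairs of vertices that is a multiplicative 1-cocycle on each simplex. -/
def IsCocycle (A : (E V).Subcomplex) (c : V → V → H) : Prop :=
  ∀ (n : SimplexCategoryᵒᵖ) (x : A.toSSet.obj n) (i j k : Fin (n.unop.len + 1)),
    c (vertices x i) (vertices x j) * c (vertices x j) (vertices x k) =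
      c (vertices x i) (vertices x k)

/-- The bundle over `|A|` with discrete fibre `H`, trivial over the open stars, with constant
transition functions given by the cocycle `c`. -/
def IsCocycle.bundle [TopologicalSpace H] [DiscreteTopology H] {A : (E V).Subcomplex}
    {c : V → V → H} (hc : IsCocycle A c) : FiberBundleCore V |A.toSSet| H where
  baseSet := openStar A
  isOpen_baseSet := isOpen_openStar A
  indexAt p := (exists_mem_openStar A p).choose
  mem_baseSet_at p := (exists_mem_openStar A p).choose_spec
  coordChange v w _ h := c w v * h
  coordChange_self v p hp h := by
    obtain ⟨n, x, t, rfl⟩ := exists_characteristicMap_eq p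
    obtain ⟨i, rfl⟩ := exists_eq_of_mem_openStar hp
    have := hc n x i i i
    rw [mul_eq_left] at this
    rw [this, one_mul]
  continuousOn_coordChange v w :=
    ((continuous_of_discreteTopology (f := fun h : H => c w v * h)).comp
      continuous_snd).continuousOn
  coordChange_comp v w z p hp h := by
    obtain ⟨n, x, t, rfl⟩ := exists_characteristicMap_eq p
    obtain ⟨i, rfl⟩ := exists_eq_of_mem_openStar hp.1.1
    obtain ⟨j, rfl⟩ := exists_eq_of_mem_openStar hp.1.2
    obtain ⟨k, rfl⟩ := exists_eq_of_mem_openStar hp.2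
    rw [← mul_assoc, hc]

/-- A covering map onto a contractible space has a section. -/
theorem _root_.IsCoveringMap.exists_section {P B : Type*} [TopologicalSpace P]
    [TopologicalSpace B] [ContractibleSpace B] {π : P → B} (hπ : IsCoveringMap π)
    (hs : Function.Surjective π) : ∃ s : C(B, P), ∀ b, π (s b) = b := by
  obtain ⟨b₀, ⟨K⟩⟩ := id_nullhomotopic B
  obtain ⟨e, he⟩ := hs b₀
  have h0 : ∀ b, K.symm.toContinuousMap (0, b) = π (ContinuousMap.const B e b) := by
    intro b
    simpa using he.symm
  -- The reversed contraction runs from a constant map to the identity. Its lift starting at the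
  -- constant `e` ends in a section.
  refine ⟨(hπ.liftHomotopy K.symm.toContinuousMap (.const B e) h0).comp
    ((ContinuousMap.const B 1).prodMk (.id B)), fun b => ?_⟩
  exact (congrFun (hπ.liftHomotopy_lifts K.symm.toContinuousMap (.const B e) h0) (1, b)).trans
    (by simp)

/-- The vertex `v` as a point of the realization. -/
def vertexPoint {A : (E V).Subcomplex} (hV : ∀ v : V, (fun _ => v) ∈ A.obj (op ⦋0⦌)) (v : V) :
    |A.toSSet| :=
  characteristicMap (X := A.toSSet) (n := op ⦋0⦌) ⟨fun _ => v, hV v⟩ (stdSimplex.vertex 0)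

theorem characteristicMap_vertex {A : (E V).Subcomplex}
    (hV : ∀ v : V, (fun _ => v) ∈ A.obj (op ⦋0⦌)) {n : SimplexCategory}
    (x : A.toSSet.obj (op n)) (i : Fin (n.len + 1)) :
    characteristicMap x (stdSimplex.vertex i) = vertexPoint hV (vertices x i) := by
  have h := characteristicMap_map (X := A.toSSet) (SimplexCategory.const ⦋0⦌ n i) x
    (stdSimplex.vertex 0)
  rw [stdSimplex.map_vertex] at h
  exact h.symm

/-- A cocycle on a contractible complex is a coboundary. -/
theorem IsCocycle.exists_potential {A : (E V).Subcomplex} [ContractibleSpace |A.toSSet|]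
    {c : V → V → H} (hc : IsCocycle A c) (hV : ∀ v : V, (fun _ => v) ∈ A.obj (op ⦋0⦌)) :
    ∃ u : V → H, ∀ (n : SimplexCategory) (x : A.toSSet.obj (op n)) (i j : Fin (n.len + 1)),
      u (vertices x j) = c (vertices x j) (vertices x i) * u (vertices x i) := by
  let _ : TopologicalSpace H := ⊥
  have _ : DiscreteTopology H := ⟨rfl⟩
  let Z := hc.bundle
  have cov : IsCoveringMap (Bundle.TotalSpace.proj : Z.TotalSpace → |A.toSSet|) :=
    FiberBundle.isCoveringMap (F := H) (E := Z.Fiber)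
  obtain ⟨s, hs⟩ := cov.exists_section fun p => ⟨⟨p, (1 : H)⟩, rfl⟩
  let idx : |A.toSSet| → V := Z.indexAt
  have hidx : ∀ {n : SimplexCategory} (x : A.toSSet.obj (op n)) t,
      ∃ i, vertices x i = idx (characteristicMap x t) := fun x t =>
    exists_eq_of_mem_openStar (Z.mem_baseSet_at (characteristicMap x t))
  -- `val p` is the coordinate of the section in the chart chosen at `p`, namely that of `idx p`.
  -- The potential at `v` is the coordinate at the point `v` in the chart of `v` itself.
  let val : |A.toSSet| → H := fun p => (s p).2
  have hval : ∀ p, s p = (⟨p, val p⟩ : Z.TotalSpace) := by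
    intro p
    rcases hsp : s p with ⟨q, h⟩
    have hq : q = p := by rw [← hs p, hsp]
    subst hq
    exact congrArg (fun r : Z.TotalSpace => (⟨q, r.2⟩ : Z.TotalSpace)) hsp.symm
  refine ⟨fun v => c v (idx (vertexPoint hV v)) * val (vertexPoint hV v),
    fun n x i j => ?_⟩
  beta_reduce
  rw [← characteristicMap_vertex hV x i, ← characteristicMap_vertex hV x j]
  set p := characteristicMap x (stdSimplex.vertex i) with hp
  set h : H := c (vertices x i) (idx p) * val p with hh
  -- The lift of the closed simplex that is constantly `h` in the chart of vertex `i`. It makes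
  -- sense even outside that open star, as `c` relates all vertices of the simplex. By unique
  -- lifting it equals `s`, which is then read off at vertex `j`.
  let lift : stdSimplex ℝ (Fin (n.len + 1)) → Z.TotalSpace := fun t =>
    ⟨characteristicMap x t, c (idx (characteristicMap x t)) (vertices x i) * h⟩
  have hlift : Continuous lift := by
    rw [continuous_iff_continuousAt]
    intro t₀
    refine (FiberBundle.continuousAt_totalSpace H lift).2
      ⟨(characteristicMap x).continuous.continuousAt, ?_⟩
    have : (fun t => (trivializationAt H Z.Fiber (lift t₀).proj (lift t)).2) =
        fun _ => c (idx (characteristicMap x t₀)) (vertices x i) * h := by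
      funext t
      change c (idx (characteristicMap x t₀)) (idx (characteristicMap x t)) *
        (c (idx (characteristicMap x t)) (vertices x i) * h) = _
      obtain ⟨k, hk⟩ := hidx x t
      obtain ⟨l, hl⟩ := hidx x t₀
      rw [← hk, ← hl, ← mul_assoc, hc]
    rw [this]
    exact continuousAt_const
  have key : (fun t => s (characteristicMap x t)) = lift := by
    refine cov.eq_of_comp_eq (s.continuous.comp (characteristicMap x).continuous) hlift
      (funext fun t => hs _) (stdSimplex.vertex i) ?_
    change s p = (⟨p, c (idx p) (vertices x i) * h⟩ : Z.TotalSpace)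
    rw [hval]
    congr 1
    obtain ⟨k, hk⟩ := hidx x (stdSimplex.vertex i)
    rw [← hp] at hk
    have hkk := hc _ x k k k
    rw [mul_eq_left] at hkk
    rw [hh, ← mul_assoc, ← hk, hc, hkk, one_mul]
  have hj : val (characteristicMap x (stdSimplex.vertex j)) =
      c (idx (characteristicMap x (stdSimplex.vertex j))) (vertices x i) * h :=
    congrArg (fun q : Z.TotalSpace => (q.2 : H)) (congrFun key (stdSimplex.vertex j))
  obtain ⟨k, hk⟩ := hidx x (stdSimplex.vertex j)
  rw [hj, ← hk, ← mul_assoc, hc]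

/-! ### Contractibility of cones -/

/-- The point `((1 - s), s t₀, …, s tₙ)` of the cone over the standard simplex. -/
def conePoint {n : ℕ} (s : unitInterval) (t : stdSimplex ℝ (Fin (n + 1))) :
    stdSimplex ℝ (Fin (n + 2)) :=
  ⟨Fin.cons (1 - (s : ℝ)) fun i => s * t i, by
    refine ⟨fun i => ?_, ?_⟩
    · refine Fin.cases ?_ (fun i => ?_) i
      · simpa using s.2.2
      · simpa using mul_nonneg s.2.1 (stdSimplex.zero_le t i)
    · rw [Fin.sum_univ_succ]
      simp only [Fin.cons_zero, Fin.cons_succ]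
      rw [← Finset.mul_sum, stdSimplex.sum_eq_one]
      ring⟩

theorem conePoint_coe {n : ℕ} (s : unitInterval) (t : stdSimplex ℝ (Fin (n + 1))) :
    ⇑(conePoint s t) = Fin.cons (1 - (s : ℝ)) fun i => s * t i := rfl

theorem continuous_conePoint {n : ℕ} :
    Continuous fun q : stdSimplex ℝ (Fin (n + 1)) × unitInterval => conePoint q.2 q.1 := by
  refine Continuous.subtype_mk (continuous_pi fun i => ?_) _
  refine Fin.cases ?_ (fun i => ?_) i
  · simp only [Fin.cons_zero]
    fun_prop
  · simp only [Fin.cons_succ]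
    exact (continuous_subtype_val.comp continuous_snd).mul
      ((continuous_apply i).comp (continuous_subtype_val.comp continuous_fst))

/-- The extension of a monotone map `[m] → [n]` to the cones. -/
def coneHom {m n : SimplexCategory} (f : m ⟶ n) : ⦋m.len + 1⦌ ⟶ ⦋n.len + 1⦌ :=
  SimplexCategory.mkHom ⟨Fin.cons 0 fun i => (f i).succ, by
    intro i j
    refine Fin.cases ?_ (fun i => ?_) i
    · simp
    · refine Fin.cases ?_ (fun j => ?_) j
      · intro h
        exact absurd h (by simp)
      · intro h
        exact Fin.succ_le_succ_iff.2 (f.toOrderHom.monotone (Fin.succ_le_succ_iff.1 h))⟩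

theorem map_coneHom_conePoint {m n : SimplexCategory} (f : m ⟶ n) (s : unitInterval)
    (t : stdSimplex ℝ (Fin (m.len + 1))) :
    stdSimplex.map (coneHom f) (conePoint s t) = conePoint s (stdSimplex.map f t) := by
  have h0 : coneHom f 0 = 0 := rfl
  have hs : ∀ i : Fin (m.len + 1), coneHom f i.succ = (f i).succ := fun _ => rfl
  ext i
  simp only [stdSimplex.map_coe, FunOnFinite.linearMap_apply_apply, conePoint_coe,
    Finset.sum_filter]
  erw [Fin.sum_univ_succ]
  rw [h0]
  simp only [hs]
  refine Fin.cases ?_ (fun i => ?_) i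
  · simp
  · simp [Finset.mul_sum, (Fin.succ_ne_zero i).symm]

theorem conePoint_zero {n : ℕ} (t : stdSimplex ℝ (Fin (n + 1))) :
    conePoint 0 t = stdSimplex.vertex 0 := by
  ext i
  refine Fin.cases ?_ (fun i => ?_) i <;> simp [conePoint_coe]

theorem conePoint_one {n : ℕ} (t : stdSimplex ℝ (Fin (n + 1))) :
    conePoint 1 t = stdSimplex.map Fin.succ t := by
  ext i
  refine Fin.cases ?_ (fun i => ?_) i <;>
    simp [conePoint_coe, FunOnFinite.linearMap_apply_apply, Finset.sum_filter]

/-- A simplicial subset of `E V` that contains all vertices and is closed under adding the vertex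
`v` in front of its simplices has a contractible realization. -/
theorem contractibleSpace_of_cone (A : (E V).Subcomplex) (v : V)
    (hV : ∀ w : V, (fun _ => w) ∈ A.obj (op ⦋0⦌))
    (hA : ∀ (n : SimplexCategory) (x : Fin (n.len + 1) → V), x ∈ A.obj (op n) →
      (Fin.cons v x : Fin (n.len + 2) → V) ∈ A.obj (op ⦋n.len + 1⦌)) :
    ContractibleSpace |A.toSSet| := by
  let cone (n : SimplexCategory) (x : A.toSSet.obj (op n)) : A.toSSet.obj (op ⦋n.len + 1⦌) :=
    ⟨(Fin.cons v (vertices x) : Fin (n.len + 2) → V), hA n x.1 x.2⟩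
  have cone_map (m n : SimplexCategory) (f : m ⟶ n) (x : A.toSSet.obj (op n)) :
      cone m (A.toSSet.map f.op x) = A.toSSet.map (coneHom f).op (cone n x) := by
    apply Subtype.ext
    funext i
    refine Fin.cases ?_ (fun i => ?_) i <;> rfl
  -- Currying the time variable lets the homotopy be glued from simplices without describing the
  -- topology of the product with the interval.
  obtain ⟨F, hF⟩ := exists_realization_desc (X := A.toSSet) (Y := C(unitInterval, |A.toSSet|))
    (fun n x => ContinuousMap.curry
      ((characteristicMap (cone n.unop x)).comp ⟨_, continuous_conePoint⟩))
    (fun m n f x t => by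
      ext s
      change characteristicMap (cone m (A.toSSet.map f.op x)) (conePoint s t) =
        characteristicMap (cone n x) (conePoint s (stdSimplex.map f t))
      rw [cone_map, characteristicMap_map, map_coneHom_conePoint])
  replace hF : ∀ (n : SimplexCategory) (x : A.toSSet.obj (op n)) t s,
      F (characteristicMap x t) s = characteristicMap (cone n x) (conePoint s t) :=
    fun n x t s => DFunLike.congr_fun (hF (op n) x t) s
  rw [contractible_iff_id_nullhomotopic]
  refine ⟨vertexPoint hV v, ContinuousMap.Homotopic.symm ⟨⟨F.uncurry.comp .prodSwap, ?_, ?_⟩⟩⟩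
  · intro p
    obtain ⟨n, x, t, rfl⟩ := exists_characteristicMap_eq p
    change F (characteristicMap x t) 0 = _
    rw [hF n.unop x t, conePoint_zero]
    exact characteristicMap_vertex hV (cone n.unop x) 0
  · intro p
    obtain ⟨n, x, t, rfl⟩ := exists_characteristicMap_eq p
    change F (characteristicMap x t) 1 = characteristicMap x t
    rw [hF n.unop x t, conePoint_one]
    exact (characteristicMap_map (SimplexCategory.δ 0 : ⦋n.unop.len⦌ ⟶ _) (cone n.unop x) t).symm

/-! ### Commutators -/

section Commutators

variable {G : Type u} [Group G]

theorem nilpotentOfClassLT_two_iff {ι : Type*} (g : ι → G) :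
    NilpotentOfClassLT 2 (Subgroup.closure (Set.range g)) ↔ ∀ i j, g i * g j = g j * g i := by
  constructor
  · rintro ⟨_, h⟩ i j
    have := (Group.IsNilpotent.nilpotencyClass_le_one_iff).1 (Nat.lt_succ_iff.1 h)
    exact congrArg Subtype.val
      (mul_comm' (⟨g i, Subgroup.subset_closure ⟨i, rfl⟩⟩ : Subgroup.closure (Set.range g))
        ⟨g j, Subgroup.subset_closure ⟨j, rfl⟩⟩)
  · intro h
    have hc : IsMulCommutative (Subgroup.closure (Set.range g)) :=
      Subgroup.isMulCommutative_closure (by rintro _ ⟨i, rfl⟩ _ ⟨j, rfl⟩; exact h i j)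
    have hn : Group.IsNilpotent (Subgroup.closure (Set.range g)) :=
      ⟨1, Subgroup.upperCentralSeries_one_eq_top_iff.2 hc⟩
    exact ⟨hn, Nat.lt_succ_iff.2 (Group.IsNilpotent.nilpotencyClass_le_one_iff.2 hc)⟩

theorem mem_Enil_two_iff {n : SimplexCategory} (x : Fin (n.len + 1) → G) :
    x ∈ (Enil 2 G).obj (op n) ↔ ∀ i j : Fin n.len,
      ((x i.castSucc)⁻¹ * x i.succ) * ((x j.castSucc)⁻¹ * x j.succ) =
        ((x j.castSucc)⁻¹ * x j.succ) * ((x i.castSucc)⁻¹ * x i.succ) :=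
  nilpotentOfClassLT_two_iff fun i : Fin n.len => (x i.castSucc)⁻¹ * x i.succ

/-- The differences of the vertices of a simplex of `E(2,G)` commute. -/
theorem commute_of_mem_Enil_two {n : SimplexCategory} {x : Fin (n.len + 1) → G}
    (hx : x ∈ (Enil 2 G).obj (op n)) (i j k l : Fin (n.len + 1)) :
    Commute ((x i)⁻¹ * x j) ((x k)⁻¹ * x l) := by
  rw [mem_Enil_two_iff] at hx
  set g : Fin n.len → G := fun i => (x i.castSucc)⁻¹ * x i.succ with hg
  -- Telescoping: the partial products of `g` are `(x 0)⁻¹ * x j`.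
  have mem : ∀ i j, (x i)⁻¹ * x j ∈ Subgroup.closure (Set.range g) := by
    intro i j
    have h := mul_mem (inv_mem (partialProd_mem_closure g i)) (partialProd_mem_closure g j)
    rw [hg, partialProd_inv_mul x, partialProd_inv_mul x, mul_inv_rev, inv_inv, mul_assoc,
      mul_inv_cancel_left] at h
    exact h
  have _ : IsMulCommutative (Subgroup.closure (Set.range g)) :=
    Subgroup.isMulCommutative_closure (by rintro _ ⟨i, rfl⟩ _ ⟨j, rfl⟩; exact hx i j)
  exact congrArg Subtype.val
    (mul_comm' (⟨_, mem i j⟩ : Subgroup.closure (Set.range g)) ⟨_, mem k l⟩)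

/-- With `b = a * g` and `c = a * g * k`, the product cancels to `⁅a, c⁆` except for a factor `g * k
* g⁻¹`, which is `k` by hypothesis. -/
theorem commutator_mul_commutator {a b c : G} (h : Commute (a⁻¹ * b) (b⁻¹ * c)) :
    ⁅a, b⁆ * ⁅b, c⁆ = ⁅a, c⁆ := by
  obtain ⟨g, rfl⟩ : ∃ g, b = a * g := ⟨a⁻¹ * b, by group⟩
  obtain ⟨k, rfl⟩ : ∃ k, c = a * g * k := ⟨(a * g)⁻¹ * c, by group⟩
  have h : g * k = k * g := by
    have := h.eq
    simpa [mul_assoc] using this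
  have h_eq : ∀ z, g * (k * (g⁻¹ * z)) = k * z := fun z => by
    rw [← mul_assoc, h, mul_assoc, mul_inv_cancel_left]
  simp only [commutatorElement_def, mul_inv_rev, mul_assoc, inv_mul_cancel_left, h_eq]

theorem isCocycle_commutator : IsCocycle (Enil 2 G) fun a b => ⁅a, b⁆ :=
  fun _ x i j k => commutator_mul_commutator (commute_of_mem_Enil_two x.2 i j j k)

end Commutators

end ClassifyingSpace

end

theorem mainTheorem5 (G : Type u) [Group G] :
    (∀ a b : G, a * b = b * a) ↔
      ContractibleSpace (SSet.toTop.obj (ClassifyingSpace.Enil 2 G).toSSet) := by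
  have hV : ∀ v : G, (fun _ => v) ∈ (ClassifyingSpace.Enil 2 G).obj (op ⦋0⦌) := fun v =>
    (ClassifyingSpace.mem_Enil_two_iff (n := ⦋0⦌) _).2 fun i => Fin.elim0 i
  constructor
  · intro h
    exact ClassifyingSpace.contractibleSpace_of_cone _ 1 hV fun n x _ =>
      (ClassifyingSpace.mem_Enil_two_iff (n := ⦋n.len + 1⦌) _).2 fun _ _ => h _ _
  · intro _ a b
    obtain ⟨u, hu⟩ := ClassifyingSpace.isCocycle_commutator.exists_potential hV
    have edge : ∀ a b : G, u b = ⁅b, a⁆ * u a := fun a b =>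
      hu ⦋1⦌ ⟨(![a, b] : Fin 2 → G), (ClassifyingSpace.mem_Enil_two_iff (n := ⦋1⦌) _).2
        fun i j => by rw [Subsingleton.elim (α := Fin 1) i j]⟩ 0 1
    have ha := edge 1 a
    have hb := edge 1 b
    have hab := edge b a
    rw [commutatorElement_one_right, one_mul] at ha hb
    rw [ha, hb, right_eq_mul] at hab
    exact commutatorElement_eq_one_iff_mul_comm.1 hab
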